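/- Let $\Gamma$ be a finitely generated non-amenable group (i.e. there is no left-invariant finitely additive probability measure on the set of all subsets of $\Gamma$), let $\Sigma$ be a finite symmetric generating set of $\Gamma$, let $G=\mathrm{Cay}(\Gamma,\Sigma)$ be the Cayley graph whose edges join $\gamma$ and $\gamma\sigma$ ($\gamma\in\Gamma$, $\sigma\in\Sigma$, $\gamma\sigma\neq\gamma$), and let $d_G$ be its shortest path metric. Let $A=\{0,1\}^{\mathbb N}\times(\mathbb N\cup\{\infty\})$, and for $y\in A^\Gamma$ let $H(y(\gamma))\in\mathbb N\cup\{\infty\}$ denote the second coordinate of $y(\gamma)$. An element $y\in A^\Gamma$ is called a landscape if $H(y(\gamma))<\infty$ for all $\gamma\in\Gamma$ and the following four conditions hold: 1. if $d_G(\gamma,\delta)=1$, then $|H(y(\gamma))-H(y(\delta))|\le 1$; 2. for every $n\ge 1$ there is an integer $M(y,n)>1$ such that whenever $H(y(\gamma))=n$ there is $\delta\in\Gamma$ with $d_G(\delta,\gamma)\le M(y,n)$ and $H(y(\delta))=1$; 3. for every $l\ge 1$ there is an integer $N(y,l)>1$ such that whenever $H(y(\gamma))=1$, the ball of radius $N(y,l)$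 in $G$ centered at $\gamma$ contains at least $l$ elements $\delta$ with $H(y(\delta))=1$; 4. for every $m\ge 1$ there is an integer $S(y,m)>1$ such that every ball of radius $S(y,m)$ in $G$ contains an element $\kappa$ with $H(y(\kappa))\ge m$. (Balls are closed.) Let $T$ be the $4$-tree, i.e. the infinite tree all of whose vertices have degree four, with its path metric $d_T$. A landscape with river is a landscape $y$ for which there are a map $\Psi:V(T)\to\Gamma$ and a constant $C>0$ such that $C^{-1}d_T(u,v)\le d_G(\Psi(u),\Psi(v))\le C\,d_T(u,v)$ for all $u,v\in V(T)$, such that $e_\Gamma\in\Psi(V(T))$, and such that $$H(y(\gamma))=d_G\big(\Psi(V(T)),\gamma\big)+1\qquad\text{for all }\gamma\in\Gamma .$$ Then there exists a landscape with river in $A^\Gamma$. -/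

import Mathlib

open scoped Pointwise ENNReal

/-- A discrete group `G` is amenable if there is a left-invariant, finitely additive probability
measure defined on all subsets of `G`. -/
def IsAmenableGroup (G : Type*) [Group G] : Prop :=
  ∃ m : Set G → ℝ≥0∞, m Set.univ = 1 ∧
    (∀ s t : Set G, Disjoint s t → m (s ∪ t) = m s + m t) ∧
    ∀ (g : G) (s : Set G), m (g • s) = m s

/-- The alphabet `A = {0,1}^ℕ × (ℕ ∪ {∞})`. -/
abbrev LandscapeAlphabet : Type := (ℕ → Bool) × ℕ∞

namespace Landscape

variable {Γ : Type*} [Group Γ]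

/-- The shortest path distance `d_G` in the right Cayley graph `G = Cay(Γ, S)`
(whose edges join `γ` and `γ * s`, `s ∈ S`). -/
noncomputable def cayleyDist (S : Finset Γ) (γ δ : Γ) : ℕ :=
  (SimpleGraph.mulCayley (S : Set Γ)).dist γ δ

/-- `y ∈ A^Γ` is of totally finite height if no height coordinate equals `∞`. -/
def TotallyFiniteHeight (y : Γ → LandscapeAlphabet) : Prop :=
  ∀ γ, (y γ).2 ≠ ⊤

/-- The height coordinate `H(y(γ))` as a natural number (meaningful for elements of totally
finite height). -/
def height (y : Γ → LandscapeAlphabet) (γ : Γ) : ℕ :=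
  (y γ).2.toNat

/-- Landscapes in `A^Γ`, with respect to the generating set `S`. -/
structure IsLandscape (S : Finset Γ) (y : Γ → LandscapeAlphabet) : Prop where
  finite_height : TotallyFiniteHeight y
  /-- The height changes by at most one along an edge. -/
  lipschitz : ∀ γ δ : Γ, cayleyDist S γ δ = 1 → |(height y γ : ℤ) - (height y δ : ℤ)| ≤ 1
  /-- A point of height `n` has a point of height `1` at distance at most `M(y,n)`. -/
  near_ground : ∀ n : ℕ, 1 ≤ n → ∃ M : ℕ, 1 < M ∧
    ∀ γ : Γ, height y γ = n → ∃ δ : Γ, cayleyDist S δ γ ≤ M ∧ height y δ = 1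
  /-- The ball of radius `N(y,l)` around a point of height `1` contains at least `l` points of
  height `1`. -/
  many_ground : ∀ l : ℕ, 1 ≤ l → ∃ N : ℕ, 1 < N ∧
    ∀ γ : Γ, height y γ = 1 →
      (l : ℕ∞) ≤ {δ : Γ | cayleyDist S γ δ ≤ N ∧ height y δ = 1}.encard
  /-- Every ball of radius `S(y,m)` contains a point of height at least `m`. -/
  high_points : ∀ m : ℕ, 1 ≤ m → ∃ R : ℕ, 1 < R ∧
    ∀ δ : Γ, ∃ κ : Γ, cayleyDist S δ κ ≤ R ∧ m ≤ height y κ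

/-- `T` is the 4-tree: a tree all of whose vertices have degree four. (Such a tree is infinite,
countable, and unique up to isomorphism.) -/
def IsFourTree {V : Type*} (T : SimpleGraph V) : Prop :=
  T.IsTree ∧ ∀ v : V, (T.neighborSet v).ncard = 4

/-- `Ψ : V(T) → Γ` is a bilipschitz embedding of the graph `T` into the Cayley graph. -/
def IsBilipschitzEmbedding (S : Finset Γ) {V : Type*} (T : SimpleGraph V) (Ψ : V → Γ) : Prop :=
  ∃ C : ℝ, 0 < C ∧ ∀ x y : V,
    C⁻¹ * (T.dist x y : ℝ) ≤ (cayleyDist S (Ψ x) (Ψ y) : ℝ) ∧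
    (cayleyDist S (Ψ x) (Ψ y) : ℝ) ≤ C * (T.dist x y : ℝ)

/-- A landscape with river: a landscape `y` for which there is a bilipschitz embedding `Ψ` of the
4-tree into the Cayley graph whose image contains the unit element, such that
`H(y(γ)) = d_G(Ψ(V(T)), γ) + 1` for all `γ`. The distance from `γ` to the image is the minimum
of the natural numbers `d_G(Ψ(v), γ)`, where `v` runs over the nonempty set `V(T)`. -/
def IsLandscapeWithRiver (S : Finset Γ) (y : Γ → LandscapeAlphabet) : Prop :=
  IsLandscape S y ∧
  ∃ (V : Type) (T : SimpleGraph V) (Ψ : V → Γ),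
    IsFourTree T ∧ IsBilipschitzEmbedding S T Ψ ∧ (1 : Γ) ∈ Set.range Ψ ∧
    ∀ γ : Γ, (y γ).2 = (((⨅ v : V, cayleyDist S (Ψ v) γ) + 1 : ℕ) : ℕ∞)

end Landscape

/-!
The point is to embed a rooted `5`-ary tree into the Cayley graph bilipschitzly; the river is then a
`4`-regular subtree of it that avoids one whole branch at every vertex.

Nonamenability enters through expansion: if no power of the ball of generators multiplied the size
of every finite set by `K`, counting densities along an almost invariant sequence would have an
ultrafilter limit that is an invariant mean (`exists_pow_expansion`). By Hall's theorem, every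
element of the group then gets `K` children at bounded distance, with disjoint families for distinct
elements (`exists_children`). So the `m`-th generation below an element has `K ^ m` distinct
members, whereas a ball of radius `m` has at most `D ^ m` elements with `D` independent of `K`.

Now map the `b`-ary tree at random into this `K`-ary one, with independent choices at all vertices.
Given the image of `u`, a vertex `v` of level `m` on another branch at the root comes within
distance `m` of it with probability at most `(D / K) ^ m` (`card_close_le`), so for large `K` a
union bound over all pairs shows that such an encounter is unlikely to happen at all
(`card_rootBad_le`). Discarding inductively the vertices where this happens, or where two children
are discarded, the probability `p` that the root is discarded stays below the fixed point of
`p ↦ 1 / (4 b²) + b² p²`, whatever the depth (`card_not_goodConfig_le`). What survives contains a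
`(b - 1)`-ary tree in which vertices at levels `n ≤ m` below their meet have images at distance at
least `m ≥ (n + m) / 2`; a compactness argument gives an infinite tree (`exists_separated_tree`).

The distance to the river is at least `L` after `L` steps along an avoided branch
(`le_cayleyDist_of_isRiverWord`), which makes points far from the river relatively dense. The other
conditions on a landscape are immediate for a distance function to a bilipschitz tree.
-/

namespace Landscape

/-! ### Expansion in nonamenable groups -/

section Expansion

variable {Γ : Type*} [Group Γ]

lemma cayley_connected {S : Finset Γ} (hgen : Subgroup.closure (S : Set Γ) = ⊤) :
    (SimpleGraph.mulCayley (S : Set Γ)).Connected := by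
  have key : ∀ x ∈ Subgroup.closure (S : Set Γ),
      ∀ g, (SimpleGraph.mulCayley (S : Set Γ)).Reachable g (g * x) := by
    intro x hx
    induction hx using Subgroup.closure_induction with
    | mem s hs =>
      intro g
      by_cases h : g = g * s
      · rw [← h]
      · exact SimpleGraph.Adj.reachable
          ((SimpleGraph.mulCayley_adj' _ _ _).2 ⟨h, s, hs, Or.inl rfl⟩)
    | one => intro g; rw [mul_one]
    | mul x y _ _ hx hy => intro g; rw [← mul_assoc]; exact (hx g).trans (hy _)
    | inv x _ hx => intro g; simpa using (hx (g * x⁻¹)).symm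
  refine (SimpleGraph.connected_iff _).2 ⟨fun g h => ?_, ⟨1⟩⟩
  simpa using key (g⁻¹ * h) (by rw [hgen]; trivial) g

lemma cayleyDist_mul_le [DecidableEq Γ] {S : Finset Γ}
    (hgen : Subgroup.closure (S : Set Γ) = ⊤) (k : ℕ) :
    ∀ g x : Γ, x ∈ (insert 1 S) ^ k → cayleyDist S g (g * x) ≤ k := by
  induction k with
  | zero => intro g x hx; simp_all [cayleyDist]
  | succ k ih =>
    intro g x hx
    rw [pow_succ] at hx
    obtain ⟨y, hy, s, hs, rfl⟩ := Finset.mem_mul.1 hx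
    refine ((cayley_connected hgen).dist_triangle (v := g * y)).trans (add_le_add (ih g y hy) ?_)
    by_cases h : g * y = g * (y * s)
    · rw [← h]; simp
    · have hs' : s ∈ S := by
        rcases Finset.mem_insert.1 hs with rfl | hs
        · simp at h
        · exact hs
      exact (SimpleGraph.dist_eq_one_iff_adj.2 ((SimpleGraph.mulCayley_adj' _ _ _).2
        ⟨h, s, hs', Or.inl (mul_assoc _ _ _)⟩)).le

lemma inv_mul_mem_of_walk [DecidableEq Γ] {S : Finset Γ} (hsymm : ∀ s ∈ S, s⁻¹ ∈ S) {g h : Γ}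
    (p : (SimpleGraph.mulCayley (S : Set Γ)).Walk g h) :
    g⁻¹ * h ∈ (insert 1 S) ^ p.length := by
  induction p with
  | nil => simp
  | @cons u v w huv p ih =>
    rw [SimpleGraph.Walk.length_cons, pow_succ']
    refine Finset.mem_mul.2 ⟨u⁻¹ * v, ?_, v⁻¹ * w, ih, by group⟩
    rcases ((SimpleGraph.mulCayley_adj _ _ _).1 huv).2 with h | h
    · exact Finset.mem_insert_of_mem h
    · refine Finset.mem_insert_of_mem ?_
      have := hsymm _ h
      rwa [mul_inv_rev, inv_inv] at this

lemma inv_mul_mem_of_cayleyDist_le [DecidableEq Γ] {S : Finset Γ} (hsymm : ∀ s ∈ S, s⁻¹ ∈ S)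
    (hgen : Subgroup.closure (S : Set Γ) = ⊤) {g h : Γ} {k : ℕ} (hk : cayleyDist S g h ≤ k) :
    g⁻¹ * h ∈ (insert 1 S) ^ k := by
  obtain ⟨p, hp⟩ := (cayley_connected hgen).exists_walk_length_eq_dist g h
  have h1 := inv_mul_mem_of_walk hsymm p
  rw [hp] at h1
  exact Finset.pow_subset_pow_right (Finset.mem_insert_self 1 S) hk h1

/-- Balls of the Cayley graph grow at most exponentially. -/
lemma exists_finset_cayleyDist_le {S : Finset Γ} (hsymm : ∀ s ∈ S, s⁻¹ ∈ S)
    (hgen : Subgroup.closure (S : Set Γ) = ⊤) (g : Γ) (k : ℕ) :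
    ∃ F : Finset Γ, (∀ h, cayleyDist S g h ≤ k → h ∈ F) ∧ F.card ≤ (S.card + 1) ^ k := by
  classical
  refine ⟨((insert 1 S) ^ k).image (g * ·), fun h hk => ?_, ?_⟩
  · exact Finset.mem_image.2 ⟨_, inv_mul_mem_of_cayleyDist_le hsymm hgen hk, by group⟩
  · exact Finset.card_image_le.trans (Finset.card_pow_le.trans
      (Nat.pow_le_pow_left (Finset.card_insert_le _ _) _))

/-- An almost invariant sequence of finite sets produces an invariant mean, as the ultrafilter
limit of the counting densities; the inverses turn almost invariance under right translations
into invariance under left translations. -/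
lemma isAmenableGroup_of_folner [DecidableEq Γ] {S : Finset Γ} (hsymm : ∀ s ∈ S, s⁻¹ ∈ S)
    (hgen : Subgroup.closure (S : Set Γ) = ⊤) (F : ℕ → Finset Γ) (hF : ∀ n, (F n).Nonempty)
    (h : ∀ n, n * (F n * insert 1 S).card ≤ (n + 1) * (F n).card) : IsAmenableGroup Γ := by
  classical
  -- the density of the inverse of `A` in `F n`
  let μ : ℕ → Set Γ → ℝ≥0∞ := fun n A =>
    (((F n).filter (fun x => x⁻¹ ∈ A)).card : ℝ≥0∞) / (F n).card
  have hpos : ∀ n, ((F n).card : ℝ≥0∞) ≠ 0 := fun n => by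
    simpa using (hF n).ne_empty
  choose m hm using fun A : Set Γ =>
    (⟨_, Ultrafilter.le_nhds_lim (Ultrafilter.map (fun n => μ n A) (Filter.hyperfilter ℕ))⟩ :
      ∃ x, Filter.Tendsto (fun n => μ n A) (Filter.hyperfilter ℕ : Filter ℕ) (nhds x))
  have hinv : Filter.Tendsto (fun n : ℕ => ((n : ℝ≥0∞))⁻¹) (Filter.hyperfilter ℕ : Filter ℕ)
      (nhds 0) :=
    ENNReal.tendsto_inv_nat_nhds_zero.mono_left
      (by rw [← Nat.cofinite_eq_atTop]; exact Filter.hyperfilter_le_cofinite)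
  have hle : ∀ s ∈ S, ∀ A : Set Γ, m (s • A) ≤ m A := by
    intro s hs A
    have h1 : ∀ n, μ n (s • A) ≤ μ n A + (n : ℝ≥0∞)⁻¹ := by
      intro n
      have hc : ((F n).filter (fun x => x⁻¹ ∈ s • A)).card + (F n).card
          ≤ ((F n).filter (fun x => x⁻¹ ∈ A)).card + (F n * insert 1 S).card := by
        have hsub : F n ⊆ F n * insert 1 S := fun x hx =>
          Finset.mem_mul.2 ⟨x, hx, 1, Finset.mem_insert_self _ _, mul_one x⟩
        have h2 : ((F n).filter (fun x => x⁻¹ ∈ s • A)).card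
            ≤ ((F n).filter (fun x => x⁻¹ ∈ A) ∪ ((F n * insert 1 S) \ F n)).card := by
          refine Finset.card_le_card_of_injOn (· * s) ?_ (fun _ _ _ _ h => mul_right_cancel h)
          intro x hx
          simp only [Finset.coe_filter, Set.mem_ofPred_eq, Set.mem_smul_set_iff_inv_smul_mem,
            smul_eq_mul] at hx
          simp only [Finset.coe_union, Finset.coe_filter, Set.mem_union, Set.mem_ofPred_eq,
            Finset.coe_sdiff, Set.mem_sdiff, Finset.mem_coe, mul_inv_rev]
          by_cases hx' : x * s ∈ F n
          · exact Or.inl ⟨hx', hx.2⟩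
          · exact Or.inr ⟨Finset.mul_mem_mul hx.1 (Finset.mem_insert_of_mem hs), hx'⟩
        have h3 := Finset.card_union_le ((F n).filter (fun x => x⁻¹ ∈ A)) ((F n * insert 1 S) \ F n)
        have h4 := Finset.card_sdiff_add_card_eq_card hsub
        omega
      have hn := h n
      have hc' : n * ((F n).filter (fun x => x⁻¹ ∈ s • A)).card
          ≤ n * ((F n).filter (fun x => x⁻¹ ∈ A)).card + (F n).card := by
        nlinarith
      rcases Nat.eq_zero_or_pos n with rfl | hn0
      · simp
      have hn1 : (n : ℝ≥0∞) ≠ 0 := by simpa using hn0.ne'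
      have hn2 : (n : ℝ≥0∞) ≠ ⊤ := ENNReal.natCast_ne_top n
      have hF2 : ((F n).card : ℝ≥0∞) ≠ ⊤ := ENNReal.natCast_ne_top _
      rw [← ENNReal.mul_le_mul_iff_right hn1 hn2, mul_add, ENNReal.mul_inv_cancel hn1 hn2]
      have : (n : ℝ≥0∞) * ((F n).filter (fun x => x⁻¹ ∈ s • A)).card
          ≤ n * ((F n).filter (fun x => x⁻¹ ∈ A)).card + (F n).card := by exact_mod_cast hc'
      calc (n : ℝ≥0∞) * μ n (s • A)
          = (n * ((F n).filter (fun x => x⁻¹ ∈ s • A)).card) / (F n).card := by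
            simp only [μ, mul_div_assoc]
        _ ≤ (n * ((F n).filter (fun x => x⁻¹ ∈ A)).card + (F n).card) / (F n).card := by gcongr
        _ = n * μ n A + 1 := by
            rw [ENNReal.add_div, ENNReal.div_self (hpos n) hF2, mul_div_assoc]
    have h2 := (hm A).add hinv
    rw [add_zero] at h2
    exact le_of_tendsto_of_tendsto' (hm (s • A)) h2 h1
  have heq : ∀ s ∈ S, ∀ A : Set Γ, m (s • A) = m A := fun s hs A =>
    le_antisymm (hle s hs A) (by simpa using hle s⁻¹ (hsymm s hs) (s • A))
  refine ⟨m, ?_, ?_, ?_⟩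
  · refine tendsto_nhds_unique (hm Set.univ) (tendsto_const_nhds.congr fun n => ?_)
    simp only [μ, Set.mem_univ, Finset.filter_true]
    exact (ENNReal.div_self (hpos n) (ENNReal.natCast_ne_top _)).symm
  · intro s t hst
    refine tendsto_nhds_unique (hm (s ∪ t)) (((hm s).add (hm t)).congr fun n => ?_)
    simp only [μ, Set.mem_union]
    rw [Finset.filter_or, Finset.card_union_of_disjoint, ← ENNReal.add_div]
    · push_cast; rfl
    · exact Finset.disjoint_filter.2 fun x _ h1 h2 => Set.disjoint_left.1 hst h1 h2
  · intro g
    have hg : g ∈ Subgroup.closure (S : Set Γ) := by rw [hgen]; trivial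
    induction hg using Subgroup.closure_induction with
    | mem s hs => exact heq s hs
    | one => intro A; rw [one_smul]
    | mul x y _ _ hx hy => intro A; rw [mul_smul, hx, hy]
    | inv x _ hx => intro A; simpa using (hx (x⁻¹ • A)).symm

/-- In a nonamenable group, large balls multiply the size of every finite set by as much as
desired. -/
lemma exists_pow_expansion [DecidableEq Γ] {S : Finset Γ} (hsymm : ∀ s ∈ S, s⁻¹ ∈ S)
    (hgen : Subgroup.closure (S : Set Γ) = ⊤) (hΓ : ¬ IsAmenableGroup Γ) (K : ℕ) :
    ∃ k, ∀ F : Finset Γ, K * F.card ≤ (F * (insert 1 S) ^ k).card := by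
  obtain ⟨n, hn⟩ : ∃ n : ℕ, ∀ F : Finset Γ,
      (n + 1) * F.card ≤ n * (F * insert 1 S).card := by
    by_contra! hcon
    choose F hF using hcon
    refine hΓ (isAmenableGroup_of_folner hsymm hgen F (fun n => ?_) fun n => (hF n).le)
    by_contra hne
    have := hF n
    rw [Finset.not_nonempty_iff_eq_empty.1 hne] at this
    simp at this
  have hpow : ∀ k, ∀ F : Finset Γ,
      (n + 1) ^ k * F.card ≤ n ^ k * (F * (insert 1 S) ^ k).card := by
    intro k
    induction k with
    | zero => intro F; simp
    | succ k ih =>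
      intro F
      have h1 := ih (F * insert 1 S)
      rw [mul_assoc, ← pow_succ'] at h1
      calc (n + 1) ^ (k + 1) * F.card = (n + 1) ^ k * ((n + 1) * F.card) := by ring
        _ ≤ (n + 1) ^ k * (n * (F * insert 1 S).card) := Nat.mul_le_mul_left _ (hn F)
        _ = n * ((n + 1) ^ k * (F * insert 1 S).card) := by ring
        _ ≤ n * (n ^ k * (F * insert 1 S ^ (k + 1)).card) := by gcongr
        _ = _ := by ring
  rcases Nat.eq_zero_or_pos n with rfl | hn0
  · refine ⟨0, fun F => ?_⟩
    have := hn F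
    simp only [zero_add, one_mul, zero_mul, nonpos_iff_eq_zero] at this
    simp [this]
  have hgt : (1 : ℝ) < (n + 1 : ℝ) / n := by
    rw [one_lt_div (by positivity)]; linarith
  obtain ⟨k, hk⟩ := pow_unbounded_of_one_lt (K : ℝ) hgt
  refine ⟨k, fun F => ?_⟩
  rw [div_pow, lt_div_iff₀ (by positivity)] at hk
  have hk' : K * n ^ k ≤ (n + 1) ^ k := by exact_mod_cast hk.le
  refine Nat.le_of_mul_le_mul_left ?_ (pow_pos hn0 k)
  calc n ^ k * (K * F.card) = K * n ^ k * F.card := by ring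
    _ ≤ (n + 1) ^ k * F.card := by gcongr
    _ ≤ _ := hpow k F

/-- By Hall's marriage theorem, the elements of a nonamenable group can be given pairwise
disjoint families of `K` children each, all at bounded distance. -/
lemma exists_children {S : Finset Γ} (hsymm : ∀ s ∈ S, s⁻¹ ∈ S)
    (hgen : Subgroup.closure (S : Set Γ) = ⊤) (hΓ : ¬ IsAmenableGroup Γ) (K : ℕ) :
    ∃ (k : ℕ) (c : Γ → Fin K → Γ), Function.Injective (fun x : Γ × Fin K => c x.1 x.2) ∧
      ∀ g i, cayleyDist S g (c g i) ≤ k := by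
  classical
  obtain ⟨k, hk⟩ := exists_pow_expansion hsymm hgen hΓ K
  have hall := (Finset.all_card_le_biUnion_card_iff_exists_injective
    (fun x : Γ × Fin K => ((insert 1 S) ^ k).image (x.1 * ·))).1 (by
      intro s
      have h1 : s.card ≤ K * (s.image Prod.fst).card := by
        have : s ⊆ (s.image Prod.fst) ×ˢ (Finset.univ : Finset (Fin K)) := fun x hx =>
          Finset.mem_product.2 ⟨Finset.mem_image_of_mem _ hx, Finset.mem_univ _⟩
        simpa [mul_comm] using Finset.card_le_card this
      refine h1.trans ((hk _).trans (Finset.card_le_card fun y hy => ?_))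
      obtain ⟨g, hg, b, hb, rfl⟩ := Finset.mem_mul.1 hy
      obtain ⟨x, hx, rfl⟩ := Finset.mem_image.1 hg
      exact Finset.mem_biUnion.2 ⟨x, hx, Finset.mem_image_of_mem _ hb⟩)
  obtain ⟨f, hf, hfm⟩ := hall
  refine ⟨k, fun g i => f (g, i), hf, fun g i => ?_⟩
  obtain ⟨b, hb, hb'⟩ := Finset.mem_image.1 (hfm (g, i))
  change cayleyDist S g (f (g, i)) ≤ k
  rw [← hb']
  exact cayleyDist_mul_le hgen k g b hb

end Expansion

/-! ### Random maps between trees -/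

section RandomTree

open Finset

section Resampling

variable {ι Y : Type*} [Fintype ι] [DecidableEq ι] [Fintype Y]

/-- Resampling one coordinate of a uniformly random function leaves its law unchanged. -/
lemma sum_card_update (P : (ι → Y) → Prop) [DecidablePred P] (j : ι) :
    ∑ e : ι → Y, #{y | P (Function.update e j y)} = Fintype.card Y * #{e | P e} := by
  have hinv : Function.Involutive
      (fun p : (ι → Y) × Y => (Function.update p.1 j p.2, p.1 j)) := fun p => by simp
  calc ∑ e : ι → Y, #{y | P (Function.update e j y)}
      = ∑ p : (ι → Y) × Y, if P (Function.update p.1 j p.2) then 1 else 0 := by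
        simp only [card_filter, Fintype.sum_prod_type]
    _ = ∑ p : (ι → Y) × Y, if P p.1 then 1 else 0 :=
        Fintype.sum_equiv hinv.toPerm _ _ fun p => rfl
    _ = Fintype.card Y * #{e | P e} := by
        simp only [card_filter, Fintype.sum_prod_type, mul_sum]
        exact sum_congr rfl fun e _ => by split_ifs <;> simp [*]

lemma card_filter_apply (Q : Y → Prop) [DecidablePred Q] (j : ι) :
    Fintype.card Y * #{e : ι → Y | Q (e j)} = Fintype.card (ι → Y) * #{y | Q y} := by
  rw [← sum_card_update (fun e => Q (e j)) j]
  simp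

lemma card_filter_apply_and (Q : Y → Prop) [DecidablePred Q] {i j : ι} (hij : i ≠ j) :
    Fintype.card Y ^ 2 * #{e : ι → Y | Q (e i) ∧ Q (e j)} =
      Fintype.card (ι → Y) * #{y | Q y} ^ 2 := by
  have h1 := sum_card_update (fun e : ι → Y => Q (e i) ∧ Q (e j)) j
  have h2 : ∑ e : ι → Y, #{y | Q (Function.update e j y i) ∧ Q (Function.update e j y j)}
      = #{e : ι → Y | Q (e i)} * #{y | Q y} := by
    rw [card_filter (fun e : ι → Y => Q (e i)), sum_mul]
    refine sum_congr rfl fun e _ => ?_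
    by_cases h : Q (e i) <;> simp [Function.update_of_ne hij, h]
  rw [h2] at h1
  calc _ = Fintype.card Y * (Fintype.card Y * #{e : ι → Y | Q (e i) ∧ Q (e j)}) := by ring
    _ = Fintype.card Y * #{e : ι → Y | Q (e i)} * #{y | Q y} := by rw [← h1]; ring
    _ = _ := by rw [card_filter_apply]; ring

end Resampling

/-- The choices that make up a map of the `b`-ary tree of depth `N` into a `K`-ary tree: each of
the `b` children of the root is sent to one of the `K` children of the image of the root, with
repetitions allowed, and carries the choices for the subtree below it. The uniform measure on
this finite type makes all the choices independent. -/
@[reducible] def TreeConfig (b K : ℕ) : ℕ → Type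
  | 0 => Unit
  | N + 1 => Fin b → Fin K × TreeConfig b K N

instance TreeConfig.instFintype (b K : ℕ) : ∀ N, Fintype (TreeConfig b K N)
  | 0 => inferInstanceAs (Fintype Unit)
  | N + 1 =>
    haveI := TreeConfig.instFintype b K N
    inferInstanceAs (Fintype (Fin b → Fin K × TreeConfig b K N))

lemma TreeConfig.card_pos {b K : ℕ} (hK : 0 < K) :
    ∀ N, 0 < Fintype.card (TreeConfig b K N)
  | 0 => Nat.one_pos
  | N + 1 => by
    have : Nonempty (Fin K × TreeConfig b K N) :=
      ⟨⟨0, hK⟩, (Fintype.card_pos_iff.1 (TreeConfig.card_pos hK N)).some⟩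
    exact Fintype.card_pos_iff.2 (inferInstanceAs (Nonempty (Fin b → Fin K × TreeConfig b K N)))

variable {X : Type*} {b K : ℕ}

/-- The image of the vertex `w` of the `b`-ary tree under the map with choices `e` that sends the
root to `g`, where `c x` lists the children of `x`. Meaningful for `w` of length at most the
depth `N`. -/
def treePos (c : X → Fin K → X) : (N : ℕ) → X → TreeConfig b K N → List (Fin b) → X
  | _, g, _, [] => g
  | 0, g, _, _ :: _ => g
  | N + 1, g, e, i :: w => treePos c N (c g (e i).1) (e i).2 w

@[simp] lemma treePos_nil (c : X → Fin K → X) (N : ℕ) (g : X) (e : TreeConfig b K N) :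
    treePos c N g e [] = g := by cases N <;> rfl

lemma treePos_cons (c : X → Fin K → X) (N : ℕ) (g : X) (e : TreeConfig b K (N + 1))
    (i : Fin b) (w : List (Fin b)) :
    treePos c (N + 1) g e (i :: w) = treePos c N (c g (e i).1) (e i).2 w := rfl

open Classical in
lemma sum_card_child_le {c : X → Fin K → X}
    (hc : Function.Injective (fun x : X × Fin K => c x.1 x.2)) {N : ℕ} {w : List (Fin b)}
    (ih : ∀ (F : Finset X) (h : X), K ^ w.length *
      ∑ g ∈ F, #{e : TreeConfig b K N | treePos c N g e w = h} ≤ Fintype.card (TreeConfig b K N))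
    (F : Finset X) (h : X) :
    K ^ (w.length + 1) *
      ∑ g ∈ F, #{y : Fin K × TreeConfig b K N | treePos c N (c g y.1) y.2 w = h} ≤
        Fintype.card (Fin K × TreeConfig b K N) := by
  have h1 : ∀ g, #{y : Fin K × TreeConfig b K N | treePos c N (c g y.1) y.2 w = h}
      = ∑ k : Fin K, #{e : TreeConfig b K N | treePos c N (c g k) e w = h} := by
    intro g
    simp only [card_filter, Fintype.sum_prod_type]
  have h2 : ∑ g ∈ F, #{y : Fin K × TreeConfig b K N | treePos c N (c g y.1) y.2 w = h}
      = ∑ g' ∈ (F ×ˢ univ).image (fun x : X × Fin K => c x.1 x.2),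
          #{e : TreeConfig b K N | treePos c N g' e w = h} := by
    rw [sum_image hc.injOn, sum_product]
    exact sum_congr rfl fun g _ => h1 g
  rw [h2, Fintype.card_prod, Fintype.card_fin, pow_succ', mul_assoc]
  exact Nat.mul_le_mul_left _ (ih _ h)

open Classical in
/-- The vertex `w` has at most a `K ^ (-w.length)` chance of landing at a given point. The sum over
the starting points, which disjointness of the families of children makes possible, is what
carries the induction. -/
lemma sum_card_treePos_le (hK : 0 < K) {c : X → Fin K → X}
    (hc : Function.Injective (fun x : X × Fin K => c x.1 x.2)) :
    ∀ (N : ℕ) (w : List (Fin b)), w.length ≤ N → ∀ (F : Finset X) (h : X),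
      K ^ w.length * ∑ g ∈ F, #{e : TreeConfig b K N | treePos c N g e w = h} ≤
        Fintype.card (TreeConfig b K N)
  | N, [], _, F, h => by
    simp only [List.length_nil, pow_zero, one_mul, treePos_nil]
    calc ∑ g ∈ F, #{e : TreeConfig b K N | g = h}
        = ∑ g ∈ F, if g = h then Fintype.card (TreeConfig b K N) else 0 := by
          refine sum_congr rfl fun g _ => ?_
          split_ifs with hg <;> simp [hg]
      _ ≤ _ := by rw [sum_ite_eq']; split_ifs <;> simp
  | N + 1, i :: w, hw, F, h => by
    have ih := sum_card_child_le hc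
      (sum_card_treePos_le hK hc N w (by simpa using hw)) F h
    have hpos : 0 < Fintype.card (Fin K × TreeConfig b K N) := by
      rw [Fintype.card_prod, Fintype.card_fin]
      exact Nat.mul_pos hK (TreeConfig.card_pos hK N)
    refine Nat.le_of_mul_le_mul_left ?_ hpos
    simp only [List.length_cons]
    have h1 : ∀ g, Fintype.card (Fin K × TreeConfig b K N) *
        #{e : TreeConfig b K (N + 1) | treePos c (N + 1) g e (i :: w) = h} =
        Fintype.card (TreeConfig b K (N + 1)) *
          #{y : Fin K × TreeConfig b K N | treePos c N (c g y.1) y.2 w = h} := fun g =>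
      card_filter_apply (ι := Fin b)
        (fun y : Fin K × TreeConfig b K N => treePos c N (c g y.1) y.2 w = h) i
    rw [mul_left_comm, mul_sum, sum_congr rfl fun g _ => h1 g, ← mul_sum, mul_left_comm,
      mul_comm (Fintype.card (Fin K × TreeConfig b K N))]
    exact Nat.mul_le_mul_left _ ih

lemma treePos_update (c : X → Fin K → X) (N : ℕ) (g : X) (e : TreeConfig b K (N + 1))
    (j : Fin b) (y : Fin K × TreeConfig b K N) {u : List (Fin b)} (hu : u.head? ≠ some j) :
    treePos c (N + 1) g (Function.update e j y : Fin b → Fin K × TreeConfig b K N) u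
      = treePos c (N + 1) g e u := by
  cases u with
  | nil => simp
  | cons i u =>
    have hij : i ≠ j := by simpa using hu
    simp only [treePos_cons, Function.update_of_ne hij]

open Classical in
/-- Two vertices on different branches at the root are unlikely to be close: given the image of
`u`, the independent image of `v` has to fall into one ball. -/
lemma card_close_le (hK : 0 < K) {c : X → Fin K → X}
    (hc : Function.Injective (fun x : X × Fin K => c x.1 x.2)) {d : X → X → ℕ} {D : ℕ}
    (hD : ∀ x m, ∃ F : Finset X, (∀ y, d x y ≤ m → y ∈ F) ∧ #F ≤ D ^ m)
    (N : ℕ) (g : X) {u v : List (Fin b)} (huv : u.head? ≠ v.head?) (hv0 : v ≠ [])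
    (hv : v.length ≤ N + 1) :
    K ^ v.length * #{e : TreeConfig b K (N + 1) |
        d (treePos c (N + 1) g e u) (treePos c (N + 1) g e v) < v.length} ≤
      D ^ v.length * Fintype.card (TreeConfig b K (N + 1)) := by
  obtain ⟨j, v, rfl⟩ := List.exists_cons_of_ne_nil hv0
  have hu : u.head? ≠ some j := by simpa using huv
  have hpos : 0 < Fintype.card (Fin K × TreeConfig b K N) := by
    rw [Fintype.card_prod, Fintype.card_fin]
    exact Nat.mul_pos hK (TreeConfig.card_pos hK N)
  refine Nat.le_of_mul_le_mul_left ?_ hpos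
  have h1 := sum_card_update (ι := Fin b) (Y := Fin K × TreeConfig b K N)
    (fun e => d (treePos c (N + 1) g e u) (treePos c (N + 1) g e (j :: v)) < (j :: v).length) j
  rw [mul_left_comm]
  refine (Nat.mul_le_mul_left _ h1.ge).trans ?_
  rw [mul_sum]
  have h2 : ∀ e : Fin b → Fin K × TreeConfig b K N, K ^ (j :: v).length *
      #{y | d (treePos c (N + 1) g (Function.update e j y : Fin b → _) u)
        (treePos c (N + 1) g (Function.update e j y : Fin b → _) (j :: v)) < (j :: v).length} ≤
      D ^ (j :: v).length * Fintype.card (Fin K × TreeConfig b K N) := by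
    intro e
    obtain ⟨F, hF, hFc⟩ := hD (treePos c (N + 1) g e u) (j :: v).length
    have hsub : ({y | d (treePos c (N + 1) g (Function.update e j y : Fin b → _) u)
        (treePos c (N + 1) g (Function.update e j y : Fin b → _) (j :: v)) < (j :: v).length} :
          Finset (Fin K × TreeConfig b K N)) ⊆
        F.biUnion fun h => {y | treePos c N (c g y.1) y.2 v = h} := by
      intro y hy
      rw [mem_filter_univ, treePos_update c N g e j y hu, treePos_cons,
        Function.update_self] at hy
      exact mem_biUnion.2 ⟨_, hF _ hy.le, by simp⟩
    calc _ ≤ K ^ (j :: v).length *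
          ∑ h ∈ F, #{y : Fin K × TreeConfig b K N | treePos c N (c g y.1) y.2 v = h} :=
          Nat.mul_le_mul_left _ ((card_le_card hsub).trans card_biUnion_le)
      _ ≤ ∑ h ∈ F, Fintype.card (Fin K × TreeConfig b K N) := by
          rw [mul_sum]
          refine sum_le_sum fun h _ => ?_
          simpa using sum_card_child_le hc
            (sum_card_treePos_le hK hc N v (by simpa using hv)) {g} h
      _ ≤ _ := by
          rw [sum_const, smul_eq_mul]
          exact Nat.mul_le_mul_right _ hFc
  refine (sum_le_sum fun e _ => h2 e).trans (le_of_eq ?_)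
  rw [sum_const, smul_eq_mul, card_univ]
  change Fintype.card (TreeConfig b K (N + 1)) * _ = _
  ring

/-- Some two vertices on different branches at the root have images closer than the larger of
their levels. -/
def RootBad (d : X → X → ℕ) (c : X → Fin K → X) (N : ℕ) (g : X) (e : TreeConfig b K N) : Prop :=
  ∃ u v : List (Fin b), u.head? ≠ v.head? ∧ u.length ≤ v.length ∧ v.length ≤ N ∧
    d (treePos c N g e u) (treePos c N g e v) < v.length

lemma sum_inv_pow_le {t : ℝ} (ht : 1 < t) (n : ℕ) :
    (t - 1) * ∑ m ∈ range n, (t ^ (m + 1))⁻¹ ≤ 1 := by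
  have h : (t - 1) * ∑ m ∈ range n, (t ^ (m + 1))⁻¹ = 1 - (t ^ n)⁻¹ := by
    induction n with
    | zero => simp
    | succ n ih =>
      rw [sum_range_succ, mul_add, ih]
      field_simp
      ring
  rw [h]
  have : 0 < (t ^ n)⁻¹ := by positivity
  linarith

open Classical in
/-- The union bound over all pairs of vertices on different branches at the root: the pairs whose
deeper member has level `m` contribute at most `(m + 1) * (b ^ 2 * D / K) ^ m ≤ (s + 1) ^ (-m)`,
which sums to at most `1 / s`. -/
lemma card_rootBad_le {D s : ℕ} (hD0 : 0 < D) (hb : 0 < b) (hs : 0 < s)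
    (hK : K = 2 * b ^ 2 * D * (s + 1)) {c : X → Fin K → X}
    (hc : Function.Injective (fun x : X × Fin K => c x.1 x.2)) {d : X → X → ℕ}
    (hD : ∀ x m, ∃ F : Finset X, (∀ y, d x y ≤ m → y ∈ F) ∧ #F ≤ D ^ m) (N : ℕ) (g : X) :
    s * #{e : TreeConfig b K (N + 1) | RootBad d c (N + 1) g e} ≤
      Fintype.card (TreeConfig b K (N + 1)) := by
  have hK0 : 0 < K := by rw [hK]; positivity
  let A : List (Fin b) → List (Fin b) → Finset (TreeConfig b K (N + 1)) := fun u v =>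
    {e | u.head? ≠ v.head? ∧ d (treePos c (N + 1) g e u) (treePos c (N + 1) g e v) < v.length}
  have hsub : ({e | RootBad d c (N + 1) g e} : Finset (TreeConfig b K (N + 1))) ⊆
      (range (N + 1)).biUnion fun m => (range (m + 2)).biUnion fun n =>
        (univ : Finset ((Fin n → Fin b) × (Fin (m + 1) → Fin b))).biUnion fun p =>
          A (List.ofFn p.1) (List.ofFn p.2) := by
    intro e he
    obtain ⟨u, v, huv, hle, hN, hd⟩ := (mem_filter_univ _).1 he
    have hv : v.length ≠ 0 := by omega
    obtain ⟨m, hm⟩ := Nat.exists_eq_succ_of_ne_zero hv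
    refine mem_biUnion.2 ⟨m, mem_range.2 (by omega), mem_biUnion.2 ⟨u.length,
      mem_range.2 (by omega), mem_biUnion.2 ⟨(u.get, fun i => v.get (i.cast hm.symm)),
      mem_univ _, ?_⟩⟩⟩
    have hv' : List.ofFn (fun i : Fin (m + 1) => v.get (i.cast hm.symm)) = v := by
      rw [← List.ofFn_congr hm v.get, List.ofFn_get]
    simp only [A, List.ofFn_get, hv']
    exact (mem_filter_univ _).2 ⟨huv, hd⟩
  set C : ℝ := ((Fintype.card (TreeConfig b K (N + 1)) : ℕ) : ℝ) with hC
  have hKR : (K : ℝ) = 2 * b ^ 2 * D * (s + 1) := by rw [hK]; push_cast; ring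
  have hbR : (1 : ℝ) ≤ b := by exact_mod_cast hb
  have hDR : (0 : ℝ) < D := by exact_mod_cast hD0
  have hA : ∀ (n m : ℕ) (p : (Fin n → Fin b) × (Fin (m + 1) → Fin b)), m ∈ range (N + 1) →
      (#(A (List.ofFn p.1) (List.ofFn p.2)) : ℝ) ≤ ((D : ℝ) / K) ^ (m + 1) * C := by
    intro n m p hm
    by_cases huv : (List.ofFn p.1).head? ≠ (List.ofFn p.2).head?
    · have := card_close_le hK0 hc hD N g huv (by simp) (by
        have := mem_range.1 hm
        simpa using (by omega : m ≤ N))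
      rw [List.length_ofFn] at this
      simp only [A, huv, ne_eq, not_false_eq_true, true_and, List.length_ofFn]
      rw [div_pow, div_mul_eq_mul_div, le_div_iff₀ (by positivity), mul_comm, hC]
      exact_mod_cast this
    · simp only [A, huv, false_and, filter_false, card_empty, Nat.cast_zero]
      positivity
  have hlevel : ∀ m ∈ range (N + 1), (∑ n ∈ range (m + 2),
      ∑ p : (Fin n → Fin b) × (Fin (m + 1) → Fin b),
        (#(A (List.ofFn p.1) (List.ofFn p.2)) : ℝ)) ≤ (((s : ℝ) + 1) ^ (m + 1))⁻¹ * C := by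
    intro m hm
    calc _ ≤ ∑ n ∈ range (m + 2), (b : ℝ) ^ (2 * (m + 1)) * (((D : ℝ) / K) ^ (m + 1) * C) := by
          refine sum_le_sum fun n hn => ?_
          refine (sum_le_sum fun p _ => hA n m p hm).trans ?_
          rw [sum_const, nsmul_eq_mul, card_univ, Fintype.card_prod, Fintype.card_fun,
            Fintype.card_fun, Fintype.card_fin, Fintype.card_fin, Fintype.card_fin]
          push_cast
          refine mul_le_mul_of_nonneg_right ?_ (by positivity)
          have : n ≤ m + 1 := by have := mem_range.1 hn; omega
          rw [← pow_add]
          exact pow_le_pow_right₀ hbR (by omega)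
      _ = ((m : ℝ) + 2) * ((b : ℝ) ^ (2 * (m + 1)) * (((D : ℝ) / K) ^ (m + 1) * C)) := by
          rw [sum_const, card_range, nsmul_eq_mul]; push_cast; rfl
      _ ≤ (2 : ℝ) ^ (m + 1) * ((b : ℝ) ^ (2 * (m + 1)) * (((D : ℝ) / K) ^ (m + 1) * C)) := by
          refine mul_le_mul_of_nonneg_right ?_ (by positivity)
          exact_mod_cast (Nat.lt_two_pow_self : m + 1 < 2 ^ (m + 1))
      _ = (2 * (b : ℝ) ^ 2 * (D / K)) ^ (m + 1) * C := by rw [pow_mul, mul_pow, mul_pow]; ring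
      _ = _ := by
          rw [hKR, ← inv_pow]
          congr 2
          have : (b : ℝ) ≠ 0 := by positivity
          have : (s : ℝ) + 1 ≠ 0 := by positivity
          field_simp
  have hle : (#{e : TreeConfig b K (N + 1) | RootBad d c (N + 1) g e} : ℝ) ≤
      ∑ m ∈ range (N + 1), (((s : ℝ) + 1) ^ (m + 1))⁻¹ * C := by
    refine le_trans ?_ (sum_le_sum hlevel)
    have h1 := (card_le_card hsub).trans <| card_biUnion_le.trans <| sum_le_sum fun m _ =>
      card_biUnion_le.trans <| sum_le_sum fun n _ => card_biUnion_le
    exact_mod_cast h1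
  rw [← sum_mul] at hle
  have hgeom := sum_inv_pow_le (t := (s : ℝ) + 1) (by
    have : (0 : ℝ) < s := by exact_mod_cast hs
    linarith) (N + 1)
  rw [add_sub_cancel_right] at hgeom
  have : (s : ℝ) * #{e : TreeConfig b K (N + 1) | RootBad d c (N + 1) g e} ≤ C := by
    calc _ ≤ (s : ℝ) * ((∑ m ∈ range (N + 1), (((s : ℝ) + 1) ^ (m + 1))⁻¹) * C) := by gcongr
      _ = ((s : ℝ) * ∑ m ∈ range (N + 1), (((s : ℝ) + 1) ^ (m + 1))⁻¹) * C := by ring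
      _ ≤ 1 * C := by gcongr
      _ = C := one_mul C
  rw [hC] at this
  exact_mod_cast this

/-- A configuration is good if its root is not bad and at most one child of the root carries a
configuration that is not good. At depth zero everything is good. -/
def GoodConfig (d : X → X → ℕ) (c : X → Fin K → X) : (N : ℕ) → X → TreeConfig b K N → Prop
  | 0, _, _ => True
  | N + 1, g, e => ¬ RootBad d c (N + 1) g e ∧ ∀ i j, i ≠ j →
      GoodConfig d c N (c g (e i).1) (e i).2 ∨ GoodConfig d c N (c g (e j).1) (e j).2

open Classical in
/-- The recursion `p' ≤ 1 / (4 b²) + b² p²` for the probability `p` of not being good keeps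
`p` below `1 / (2 b²)`. -/
lemma card_not_goodConfig_le {D : ℕ} (hD0 : 0 < D) (hb : 0 < b)
    (hK : K = 2 * b ^ 2 * D * (4 * b ^ 2 + 1)) {c : X → Fin K → X}
    (hc : Function.Injective (fun x : X × Fin K => c x.1 x.2)) {d : X → X → ℕ}
    (hD : ∀ x m, ∃ F : Finset X, (∀ y, d x y ≤ m → y ∈ F) ∧ #F ≤ D ^ m) :
    ∀ (N : ℕ) (g : X), 2 * b ^ 2 * #{e : TreeConfig b K N | ¬ GoodConfig d c N g e} ≤
      Fintype.card (TreeConfig b K N)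
  | 0, g => by simp [GoodConfig]
  | N + 1, g => by
    have hK0 : 0 < K := by rw [hK]; positivity
    have ih := card_not_goodConfig_le hD0 hb hK hc hD N
    let Q : Fin K × TreeConfig b K N → Prop := fun y => ¬ GoodConfig d c N (c g y.1) y.2
    have hQ : 2 * b ^ 2 * #{y | Q y} ≤ Fintype.card (Fin K × TreeConfig b K N) := by
      have : #{y | Q y} = ∑ k : Fin K,
          #{e : TreeConfig b K N | ¬ GoodConfig d c N (c g k) e} := by
        simp only [Q, card_filter, Fintype.sum_prod_type]
      rw [this, mul_sum, Fintype.card_prod]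
      refine (sum_le_sum fun k _ => ih (c g k)).trans ?_
      simp
    have hpos : 0 < Fintype.card (Fin K × TreeConfig b K N) := by
      rw [Fintype.card_prod, Fintype.card_fin]
      exact Nat.mul_pos hK0 (TreeConfig.card_pos hK0 N)
    have hroot := card_rootBad_le hD0 hb (by positivity) hK hc hD N g
    set C := Fintype.card (TreeConfig b K (N + 1)) with hC
    have hpair : ∀ i j : Fin b, i ≠ j → (2 * b ^ 2) ^ 2 *
        #{e : Fin b → Fin K × TreeConfig b K N | Q (e i) ∧ Q (e j)} ≤ C := by
      intro i j hij
      refine Nat.le_of_mul_le_mul_left ?_ (pow_pos hpos 2)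
      rw [mul_left_comm, card_filter_apply_and Q hij]
      change (2 * b ^ 2) ^ 2 * (C * _) ≤ _
      calc _ = C * (2 * b ^ 2 * #{y | Q y}) ^ 2 := by ring
        _ ≤ C * Fintype.card (Fin K × TreeConfig b K N) ^ 2 := by gcongr
        _ = _ := by ring
    have hsub : ({e | ¬ GoodConfig d c (N + 1) g e} : Finset (TreeConfig b K (N + 1))) ⊆
        ({e | RootBad d c (N + 1) g e} : Finset (TreeConfig b K (N + 1))) ∪
        (univ : Finset (Fin b × Fin b)).biUnion fun p =>
          ({e | p.1 ≠ p.2 ∧ Q (e p.1) ∧ Q (e p.2)} :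
            Finset (Fin b → Fin K × TreeConfig b K N)) := by
      intro e he
      have he := (mem_filter_univ _).1 he
      by_cases hr : RootBad d c (N + 1) g e
      · exact mem_union_left _ ((mem_filter_univ _).2 hr)
      · simp only [GoodConfig, not_and] at he
        have := he hr
        push Not at this
        obtain ⟨i, j, hij, hi, hj⟩ := this
        exact mem_union_right _ (mem_biUnion.2 ⟨(i, j), mem_univ _,
          (mem_filter_univ _).2 ⟨hij, hi, hj⟩⟩)
    have hcard := (card_le_card hsub).trans <| (card_union_le _ _).trans <|
      Nat.add_le_add_left card_biUnion_le _
    have hsum : (2 * b ^ 2) ^ 2 * ∑ p : Fin b × Fin b,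
        #{e : Fin b → Fin K × TreeConfig b K N | p.1 ≠ p.2 ∧ Q (e p.1) ∧ Q (e p.2)} ≤
          b ^ 2 * C := by
      rw [mul_sum]
      calc _ ≤ ∑ p : Fin b × Fin b, C := by
            refine sum_le_sum fun p _ => ?_
            by_cases hp : p.1 = p.2
            · simp [hp]
            · simpa [hp] using hpair p.1 p.2 hp
        _ = b ^ 2 * C := by simp [sq]
    have hsum' : 4 * b ^ 2 * ∑ p : Fin b × Fin b,
        #{e : Fin b → Fin K × TreeConfig b K N | p.1 ≠ p.2 ∧ Q (e p.1) ∧ Q (e p.2)} ≤ C := by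
      refine Nat.le_of_mul_le_mul_left ?_ (pow_pos hb 2)
      refine le_trans (le_of_eq ?_) hsum
      ring
    nlinarith

lemma exists_goodConfig {D : ℕ} (hD0 : 0 < D) (hb : 0 < b)
    (hK : K = 2 * b ^ 2 * D * (4 * b ^ 2 + 1)) {c : X → Fin K → X}
    (hc : Function.Injective (fun x : X × Fin K => c x.1 x.2)) {d : X → X → ℕ}
    (hD : ∀ x m, ∃ F : Finset X, (∀ y, d x y ≤ m → y ∈ F) ∧ #F ≤ D ^ m) (N : ℕ) (g : X) :
    ∃ e : TreeConfig b K N, GoodConfig d c N g e := by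
  classical
  by_contra! hcon
  have h := card_not_goodConfig_le hD0 hb hK hc hD N g
  rw [filter_true_of_mem fun e _ => hcon e, card_univ] at h
  have hpos : 0 < Fintype.card (TreeConfig b K N) :=
    TreeConfig.card_pos (by rw [hK]; positivity) N
  have : 0 < b ^ 2 := pow_pos hb 2
  nlinarith

end RandomTree

/-! ### Extraction of an infinite separated tree -/

section Extraction

variable {X : Type*} {a b K : ℕ}

/-- A good configuration of the `(a + 1)`-ary tree contains an `a`-ary subtree, described by the
relabelling `σ` of words, all of whose branchings are separated. -/
lemma exists_subtree_of_goodConfig {d : X → X → ℕ} {c : X → Fin K → X} {k : ℕ}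
    (hk : ∀ g i, d g (c g i) ≤ k) :
    ∀ (N : ℕ) (g : X) (e : TreeConfig (a + 1) K N), GoodConfig d c N g e →
      ∃ σ : List (Fin a) → List (Fin (a + 1)), (∀ w, (σ w).length = w.length) ∧
        (∀ w i, w.length < N → d (treePos c N g e (σ w)) (treePos c N g e (σ (w ++ [i]))) ≤ k) ∧
        ∀ w u v, u.head? ≠ v.head? → u.length ≤ v.length → (w ++ v).length ≤ N →
          v.length ≤ d (treePos c N g e (σ (w ++ u))) (treePos c N g e (σ (w ++ v)))
  | 0, g, e, _ => by
    refine ⟨fun w => w.map Fin.castSucc, by simp, fun w i hw => by omega, ?_⟩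
    intro w u v _ _ hN
    simp only [List.length_append] at hN
    omega
  | N + 1, g, e, he => by
    obtain ⟨hroot, hgood⟩ := he
    -- all children but possibly `i₀` carry good configurations
    obtain ⟨i₀, hi₀⟩ : ∃ i₀, ∀ i, i ≠ i₀ → GoodConfig d c N (c g (e i).1) (e i).2 := by
      by_cases h : ∃ i, ¬ GoodConfig d c N (c g (e i).1) (e i).2
      · obtain ⟨i₀, hi₀⟩ := h
        exact ⟨i₀, fun i hi => (hgood i i₀ hi).resolve_right hi₀⟩
      · push Not at h
        exact ⟨0, fun i _ => h i⟩
    choose τ hlen hstep hsep using fun i : Fin a =>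
      exists_subtree_of_goodConfig hk N (c g (e (i₀.succAbove i)).1) (e (i₀.succAbove i)).2
        (hi₀ _ (Fin.succAbove_ne i₀ i))
    let σ : List (Fin a) → List (Fin (a + 1)) := fun w =>
      match w with
      | [] => []
      | i :: w => i₀.succAbove i :: τ i w
    have hσlen : ∀ w, (σ w).length = w.length := by
      intro w
      cases w <;> simp [σ, hlen]
    have hσhead : ∀ w, (σ w).head? = w.head?.map i₀.succAbove := by
      intro w
      cases w <;> simp [σ]
    refine ⟨σ, hσlen, ?_, ?_⟩
    · intro w i hw
      cases w with
      | nil =>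
        have h0 : τ i [] = [] := List.eq_nil_of_length_eq_zero (hlen i [])
        simp only [σ, List.nil_append, h0, treePos_cons, treePos_nil]
        exact hk _ _
      | cons j w => exact hstep j w i (by simpa using hw)
    · intro w u v huv hle hN
      cases w with
      | nil =>
        by_contra! hlt
        refine hroot ⟨σ u, σ v, ?_, by rwa [hσlen, hσlen], by rw [hσlen]; exact hN, ?_⟩
        · rw [hσhead, hσhead]
          exact fun h => huv (Option.map_injective (Fin.succAbove_right_injective (p := i₀)) h)
        · rw [hσlen]; exact hlt
      | cons j w => exact hsep j w u v huv hle (by simpa using hN)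

/-- Finite trees of all depths with bounded steps and separated branchings, rooted at the same
point of a locally finite space, accumulate at an infinite tree with these properties. -/
lemma exists_infinite_tree {d : X → X → ℕ} (hfin : ∀ x m, {y | d x y ≤ m}.Finite) {k : ℕ} {g : X}
    (h : ∀ N, ∃ ψ : List (Fin a) → X, ψ [] = g ∧
      (∀ w i, w.length < N → d (ψ w) (ψ (w ++ [i])) ≤ k) ∧
      ∀ w u v, u.head? ≠ v.head? → u.length ≤ v.length → (w ++ v).length ≤ N →
        v.length ≤ d (ψ (w ++ u)) (ψ (w ++ v))) :
    ∃ ψ : List (Fin a) → X, ψ [] = g ∧ (∀ w i, d (ψ w) (ψ (w ++ [i])) ≤ k) ∧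
      ∀ w u v, u.head? ≠ v.head? → u.length ≤ v.length →
        v.length ≤ d (ψ (w ++ u)) (ψ (w ++ v)) := by
  choose φ hroot hstep hsep using h
  have hrange : ∀ w : List (Fin a), ∃ F : Set X, F.Finite ∧ ∀ N, w.length ≤ N → φ N w ∈ F := by
    intro w
    induction w using List.reverseRecOn with
    | nil => exact ⟨{g}, Set.finite_singleton g, fun N _ => hroot N⟩
    | append_singleton w i ih =>
      obtain ⟨F, hF, hFm⟩ := ih
      refine ⟨⋃ x ∈ F, {y | d x y ≤ k}, hF.biUnion fun x _ => hfin x k, fun N hN => ?_⟩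
      have hN' : w.length < N := by simpa using hN
      exact Set.mem_biUnion (hFm N hN'.le) (hstep N w i hN')
  have hge : ∀ n : ℕ, ∀ᶠ N in (Filter.hyperfilter ℕ : Filter ℕ), n ≤ N := fun n =>
    (Filter.eventually_ge_atTop n).filter_mono
      (by rw [← Nat.cofinite_eq_atTop]; exact Filter.hyperfilter_le_cofinite)
  have hlim : ∀ w : List (Fin a), ∃ x, ∀ᶠ N in (Filter.hyperfilter ℕ : Filter ℕ), φ N w = x := by
    intro w
    obtain ⟨F, hF, hFm⟩ := hrange w
    obtain ⟨x, _, hx⟩ := (Ultrafilter.eventually_exists_mem_iff (f := Filter.hyperfilter ℕ)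
      (P := fun x N => φ N w = x) hF).1
      ((hge w.length).mono fun N hN => ⟨_, hFm N hN, rfl⟩)
    exact ⟨x, hx⟩
  choose ψ hψ using hlim
  refine ⟨ψ, ?_, ?_, ?_⟩
  · obtain ⟨N, hN⟩ := (hψ []).exists
    rw [← hN, hroot]
  · intro w i
    obtain ⟨N, h1, h2, h3⟩ := ((hψ w).and ((hψ (w ++ [i])).and (hge (w.length + 1)))).exists
    rw [← h1, ← h2]
    exact hstep N w i h3
  · intro w u v huv hle
    obtain ⟨N, h1, h2, h3⟩ :=
      ((hψ (w ++ u)).and ((hψ (w ++ v)).and (hge (w ++ v).length))).exists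
    rw [← h1, ← h2]
    exact hsep N w u v huv hle h3

/-- Every nonamenable group contains a bilipschitz `a`-ary tree rooted at the unit element. -/
lemma exists_separated_tree {Γ : Type*} [Group Γ] {S : Finset Γ}
    (hsymm : ∀ s ∈ S, s⁻¹ ∈ S) (hgen : Subgroup.closure (S : Set Γ) = ⊤)
    (hΓ : ¬ IsAmenableGroup Γ) (a : ℕ) :
    ∃ (k : ℕ) (ψ : List (Fin a) → Γ), ψ [] = 1 ∧
      (∀ w i, cayleyDist S (ψ w) (ψ (w ++ [i])) ≤ k) ∧
      ∀ w u v, u.head? ≠ v.head? → u.length ≤ v.length →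
        v.length ≤ cayleyDist S (ψ (w ++ u)) (ψ (w ++ v)) := by
  obtain ⟨k, c, hc, hk⟩ := exists_children hsymm hgen hΓ
    (2 * (a + 1) ^ 2 * (S.card + 1) * (4 * (a + 1) ^ 2 + 1))
  have hball := exists_finset_cayleyDist_le hsymm hgen
  refine ⟨k, exists_infinite_tree (fun x m => ?_) fun N => ?_⟩
  · obtain ⟨F, hF, _⟩ := hball x m
    exact F.finite_toSet.subset hF
  · obtain ⟨e, he⟩ := exists_goodConfig (b := a + 1) (Nat.succ_pos _) (Nat.succ_pos _) rfl hc
      hball N 1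
    obtain ⟨σ, hlen, hstep, hsep⟩ := exists_subtree_of_goodConfig hk N 1 e he
    refine ⟨fun w => treePos c N 1 e (σ w), ?_, hstep, hsep⟩
    have h0 : σ [] = [] := List.eq_nil_of_length_eq_zero (hlen [])
    simp only [h0, treePos_nil]

end Extraction

/-! ### The graph of words -/

lemma exists_common_prefix {α : Type*} [DecidableEq α] : ∀ x y : List α,
    ∃ w u v, x = w ++ u ∧ y = w ++ v ∧ (u.head? ≠ v.head? ∨ u = [] ∧ v = [])
  | [], [] => ⟨[], [], [], by simp⟩
  | [], j :: y => ⟨[], [], j :: y, by simp⟩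
  | i :: x, [] => ⟨[], i :: x, [], by simp⟩
  | i :: x, j :: y => by
    by_cases hij : i = j
    · obtain ⟨w, u, v, rfl, rfl, h⟩ := exists_common_prefix x y
      exact ⟨i :: w, u, v, rfl, by rw [hij]; rfl, h⟩
    · exact ⟨[], i :: x, j :: y, rfl, rfl, by simp [hij]⟩

/-- The graph on the words satisfying `p` in which every word is joined to its tail; a word is
read from its last letter to its first, so that the children of `x` are the words `i :: x`. -/
def wordTree {α : Type*} (p : List α → Prop) : SimpleGraph {l // p l} where
  Adj x y := (∃ i, y.1 = i :: x.1) ∨ ∃ i, x.1 = i :: y.1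
  symm := ⟨fun _ _ h => h.symm⟩
  loopless := ⟨fun x h => by rcases h with ⟨i, hi⟩ | ⟨i, hi⟩ <;> simp at hi⟩

section WordTree

variable {α : Type*} {p : List α → Prop}

lemma wordTree_exists_walk (htail : ∀ i l, p (i :: l) → p l) :
    ∀ (u w : List α) (hu : p (u ++ w)) (hw : p w),
      ∃ q : (wordTree p).Walk ⟨u ++ w, hu⟩ ⟨w, hw⟩, q.length = u.length
  | [], w, _, _ => ⟨SimpleGraph.Walk.nil, rfl⟩
  | i :: u, w, hu, hw => by
    obtain ⟨q, hq⟩ := wordTree_exists_walk htail u w (htail i _ hu) hw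
    have hadj : (wordTree p).Adj ⟨i :: u ++ w, hu⟩ ⟨u ++ w, htail i _ hu⟩ := Or.inr ⟨i, rfl⟩
    exact ⟨SimpleGraph.Walk.cons hadj q, by simp [hq]⟩

lemma wordTree_connected (hnil : p []) (htail : ∀ i l, p (i :: l) → p l) :
    (wordTree p).Connected := by
  have h : ∀ x : {l // p l}, (wordTree p).Reachable x ⟨[], hnil⟩ := by
    rintro ⟨x, hx⟩
    obtain ⟨q, _⟩ := wordTree_exists_walk htail x [] (by simpa using hx) hnil
    simpa using q.reachable
  exact (SimpleGraph.connected_iff _).2 ⟨fun x y => (h x).trans (h y).symm, ⟨⟨[], hnil⟩⟩⟩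

/-- Deleting the edge above `y` separates the words that end in `y` from all others. -/
lemma wordTree_isAcyclic : (wordTree p).IsAcyclic := by
  have key : ∀ (x y : {l // p l}) (i : α), y.1 = i :: x.1 → (wordTree p).IsBridge s(x, y) := by
    intro x y i hi
    rw [SimpleGraph.isBridge_iff]
    rintro ⟨q⟩
    have hstep : ∀ (z z' : {l // p l}) (j : α), z'.1 = j :: z.1 → s(z, z') ≠ s(x, y) →
        (y.1 <:+ z'.1 ↔ y.1 <:+ z.1) := by
      intro z z' j hj hne
      rw [hj, List.suffix_cons_iff]
      refine or_iff_right fun h => hne ?_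
      rw [hi, List.cons.injEq] at h
      have h1 : x = z := Subtype.ext h.2
      have h2 : y = z' := Subtype.ext (by rw [hi, hj, h.1, h.2])
      rw [h1, h2]
    have hinv : ∀ {z z' : {l // p l}}, ((wordTree p).deleteEdges {s(x, y)}).Walk z z' →
        (y.1 <:+ z'.1 ↔ y.1 <:+ z.1) := by
      intro z z' r
      induction r with
      | nil => rfl
      | cons hadj _ ih =>
        rw [ih]
        rw [SimpleGraph.deleteEdges_adj] at hadj
        obtain ⟨⟨j, hj⟩ | ⟨j, hj⟩, hne⟩ := hadj
        · exact hstep _ _ j hj hne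
        · exact (hstep _ _ j hj (by rw [Sym2.eq_swap]; exact hne)).symm
    have hx := (hinv q).1 List.suffix_rfl
    have := hx.length_le
    rw [hi, List.length_cons] at this
    omega
  rw [SimpleGraph.isAcyclic_iff_forall_adj_isBridge]
  rintro x y (⟨i, hi⟩ | ⟨i, hi⟩)
  · exact key x y i hi
  · rw [Sym2.eq_swap]
    exact key y x i hi

lemma wordTree_dist_le (hnil : p []) (htail : ∀ i l, p (i :: l) → p l) {u v w : List α}
    (hu : p (u ++ w)) (hv : p (v ++ w)) :
    (wordTree p).dist ⟨u ++ w, hu⟩ ⟨v ++ w, hv⟩ ≤ u.length + v.length := by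
  have hw : p w := by
    clear hv
    induction u with
    | nil => exact hu
    | cons i u ih => exact ih (htail i _ hu)
  obtain ⟨q, hq⟩ := wordTree_exists_walk htail u w hu hw
  obtain ⟨r, hr⟩ := wordTree_exists_walk htail v w hv hw
  rw [← hq, ← hr]
  refine ((wordTree_connected hnil htail).dist_triangle (v := ⟨w, hw⟩)).trans
    (add_le_add (SimpleGraph.dist_le q) ?_)
  rw [SimpleGraph.dist_comm]
  exact SimpleGraph.dist_le r

end WordTree

/-! ### The four-tree of river words -/

/-- The words over five letters that span a `4`-regular subtree of the rooted `5`-ary tree: the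
root has the four children `0, 1, 2, 3`, all other vertices have the three children `0, 1, 2`, and
the branches along the letter `4` are left out everywhere. The first step away from the root is
the last letter of the word. -/
def IsRiverWord (l : List (Fin 5)) : Prop := 4 ∉ l ∧ 3 ∉ l.dropLast

lemma isRiverWord_nil : IsRiverWord [] := by simp [IsRiverWord]

lemma IsRiverWord.of_cons {i : Fin 5} {l : List (Fin 5)} (h : IsRiverWord (i :: l)) :
    IsRiverWord l := by
  refine ⟨fun h4 => h.1 (List.mem_cons_of_mem _ h4), fun h3 => h.2 ?_⟩
  cases l with
  | nil => simp at h3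
  | cons j l => exact List.mem_cons_of_mem _ h3

lemma isRiverWord_singleton_iff {i : Fin 5} : IsRiverWord [i] ↔ i ≠ 4 := by
  simp [IsRiverWord, eq_comm]

lemma IsRiverWord.cons_iff {i j : Fin 5} {l : List (Fin 5)} (h : IsRiverWord (j :: l)) :
    IsRiverWord (i :: j :: l) ↔ i = 0 ∨ i = 1 ∨ i = 2 := by
  obtain ⟨h4, h3⟩ := h
  have : IsRiverWord (i :: j :: l) ↔ i ≠ 3 ∧ i ≠ 4 := by
    simp only [IsRiverWord, List.dropLast_cons_cons, List.mem_cons (a := 4) (b := i),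
      List.mem_cons (a := 3) (b := i), h4, h3, or_false]
    tauto
  rw [this]
  clear this
  revert i
  decide

lemma IsRiverWord.replicate_append {l : List (Fin 5)} (h : IsRiverWord l) :
    ∀ n : ℕ, IsRiverWord (List.replicate n 0 ++ l)
  | 0 => h
  | n + 1 => by
    have ih := h.replicate_append n
    rw [List.replicate_succ, List.cons_append]
    cases hl : List.replicate n 0 ++ l with
    | nil => exact isRiverWord_singleton_iff.2 (by decide)
    | cons j m => exact (IsRiverWord.cons_iff (hl ▸ ih)).2 (Or.inl rfl)

lemma isFourTree_wordTree_isRiverWord : IsFourTree (wordTree IsRiverWord) := by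
  refine ⟨⟨wordTree_connected isRiverWord_nil fun _ _ h => h.of_cons, wordTree_isAcyclic⟩, ?_⟩
  rintro ⟨x, hx⟩
  rw [← Set.ncard_image_of_injective _ Subtype.val_injective]
  cases x with
  | nil =>
    have : Subtype.val '' (wordTree IsRiverWord).neighborSet ⟨[], hx⟩ =
        (({[0], [1], [2], [3]} : Finset (List (Fin 5))) : Set (List (Fin 5))) := by
      ext y
      simp only [Set.mem_image, SimpleGraph.mem_neighborSet, wordTree, Subtype.exists,
        exists_and_right, exists_eq_right, Finset.coe_insert, Finset.coe_singleton,
        Set.mem_insert_iff, Set.mem_singleton_iff]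
      constructor
      · rintro ⟨hy, ⟨i, rfl⟩ | ⟨i, hi⟩⟩
        · rw [isRiverWord_singleton_iff] at hy
          revert hy i
          decide
        · simp at hi
      · rintro (rfl | rfl | rfl | rfl) <;>
          exact ⟨isRiverWord_singleton_iff.2 (by decide), Or.inl ⟨_, rfl⟩⟩
    rw [this, Set.ncard_coe_finset]
    rfl
  | cons j l =>
    have : Subtype.val '' (wordTree IsRiverWord).neighborSet ⟨j :: l, hx⟩ =
        (({l, 0 :: j :: l, 1 :: j :: l, 2 :: j :: l} : Finset (List (Fin 5))) :
          Set (List (Fin 5))) := by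
      ext y
      simp only [Set.mem_image, SimpleGraph.mem_neighborSet, wordTree, Subtype.exists,
        exists_and_right, exists_eq_right, Finset.coe_insert, Finset.coe_singleton,
        Set.mem_insert_iff, Set.mem_singleton_iff]
      constructor
      · rintro ⟨hy, ⟨i, rfl⟩ | ⟨i, hi⟩⟩
        · rw [IsRiverWord.cons_iff hx] at hy
          rcases hy with rfl | rfl | rfl <;> simp
        · exact Or.inl (List.cons.inj hi).2.symm
      · rintro (rfl | rfl | rfl | rfl)
        · exact ⟨hx.of_cons, Or.inr ⟨_, rfl⟩⟩
        all_goals exact ⟨(IsRiverWord.cons_iff hx).2 (by decide), Or.inl ⟨_, rfl⟩⟩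
    have hne : ∀ i, l ≠ i :: j :: l := fun i h => by
      have := congrArg List.length h
      simp only [List.length_cons] at this
      omega
    rw [this, Set.ncard_coe_finset, Finset.card_insert_of_notMem, Finset.card_insert_of_notMem,
      Finset.card_pair]
    all_goals simp [hne]

/-! ### The river and its landscape -/

section River

variable {Γ : Type*} [Group Γ] {S : Finset Γ} {a k : ℕ} {ψ : List (Fin a) → Γ}

lemma cayleyDist_comm (g h : Γ) : cayleyDist S g h = cayleyDist S h g := SimpleGraph.dist_comm

lemma cayleyDist_triangle (hgen : Subgroup.closure (S : Set Γ) = ⊤) (f g h : Γ) :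
    cayleyDist S f h ≤ cayleyDist S f g + cayleyDist S g h :=
  (cayley_connected hgen).dist_triangle

lemma cayleyDist_append_le (hgen : Subgroup.closure (S : Set Γ) = ⊤)
    (hstep : ∀ w i, cayleyDist S (ψ w) (ψ (w ++ [i])) ≤ k) (w u : List (Fin a)) :
    cayleyDist S (ψ w) (ψ (w ++ u)) ≤ k * u.length := by
  induction u using List.reverseRecOn with
  | nil => simp [cayleyDist]
  | append_singleton u i ih =>
    rw [← List.append_assoc, List.length_append, List.length_singleton, mul_add, mul_one]
    exact (cayleyDist_triangle hgen _ _ _).trans (add_le_add ih (hstep _ i))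

/-- The separation of branchings without an assumption on the order of the two levels. -/
lemma length_le_cayleyDist
    (hsep : ∀ w u v, u.head? ≠ v.head? → u.length ≤ v.length →
      v.length ≤ cayleyDist S (ψ (w ++ u)) (ψ (w ++ v))) {w u v : List (Fin a)}
    (huv : u.head? ≠ v.head? ∨ u = [] ∧ v = []) :
    u.length ≤ cayleyDist S (ψ (w ++ u)) (ψ (w ++ v)) ∧
      v.length ≤ cayleyDist S (ψ (w ++ u)) (ψ (w ++ v)) := by
  rcases huv with huv | ⟨rfl, rfl⟩
  · rcases le_total u.length v.length with h | h
    · have := hsep w u v huv h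
      exact ⟨h.trans this, this⟩
    · have := hsep w v u huv.symm h
      rw [cayleyDist_comm] at this
      exact ⟨this, h.trans this⟩
  · simp

lemma injective_of_separated
    (hsep : ∀ w u v, u.head? ≠ v.head? → u.length ≤ v.length →
      v.length ≤ cayleyDist S (ψ (w ++ u)) (ψ (w ++ v))) : Function.Injective ψ := by
  intro x y hxy
  obtain ⟨w, u, v, rfl, rfl, huv⟩ := exists_common_prefix x y
  have h := length_le_cayleyDist hsep (w := w) huv
  rw [hxy] at h
  simp only [cayleyDist, SimpleGraph.dist_self, nonpos_iff_eq_zero,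
    List.length_eq_zero_iff] at h
  rw [h.1, h.2]

lemma isBilipschitzEmbedding_wordTree (hgen : Subgroup.closure (S : Set Γ) = ⊤)
    {p : List (Fin a) → Prop} (hnil : p []) (htail : ∀ i l, p (i :: l) → p l)
    (hstep : ∀ w i, cayleyDist S (ψ w) (ψ (w ++ [i])) ≤ k)
    (hsep : ∀ w u v, u.head? ≠ v.head? → u.length ≤ v.length →
      v.length ≤ cayleyDist S (ψ (w ++ u)) (ψ (w ++ v))) :
    IsBilipschitzEmbedding S (wordTree p) (fun x => ψ x.1.reverse) := by
  refine ⟨k + 2, by positivity, fun x y => ⟨?_, ?_⟩⟩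
  · obtain ⟨w, u, v, hx, hy, huv⟩ := exists_common_prefix x.1.reverse y.1.reverse
    have h := length_le_cayleyDist hsep (w := w) huv
    rw [← hx, ← hy] at h
    obtain ⟨x, hpx⟩ := x
    obtain ⟨y, hpy⟩ := y
    obtain rfl : x = u.reverse ++ w.reverse := by
      rw [← List.reverse_append, ← hx, List.reverse_reverse]
    obtain rfl : y = v.reverse ++ w.reverse := by
      rw [← List.reverse_append, ← hy, List.reverse_reverse]
    have hT := wordTree_dist_le hnil htail hpx hpy
    rw [List.length_reverse, List.length_reverse] at hT
    rw [inv_mul_le_iff₀ (by positivity)]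
    have h2 := hT.trans (add_le_add h.1 h.2)
    refine (Nat.cast_le (α := ℝ).2 h2).trans ?_
    push_cast
    rw [← two_mul]
    refine mul_le_mul_of_nonneg_right ?_ (Nat.cast_nonneg _)
    have : (0 : ℝ) ≤ k := Nat.cast_nonneg k
    linarith
  · have hwalk : ∀ {x y : {l // p l}} (q : (wordTree p).Walk x y),
        cayleyDist S (ψ x.1.reverse) (ψ y.1.reverse) ≤ k * q.length := by
      intro x y q
      induction q with
      | nil => simp [cayleyDist]
      | @cons x z y hadj q ih =>
        rw [SimpleGraph.Walk.length_cons, mul_add, mul_one, add_comm]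
        refine (cayleyDist_triangle hgen _ (ψ z.1.reverse) _).trans (add_le_add ?_ ih)
        rcases hadj with ⟨i, hi⟩ | ⟨i, hi⟩
        · rw [hi, List.reverse_cons]
          exact hstep _ i
        · rw [hi, List.reverse_cons]
          exact (cayleyDist_comm _ _).trans_le (hstep _ i)
    obtain ⟨q, hq⟩ := (wordTree_connected hnil htail).exists_walk_length_eq_dist x y
    have h := hwalk q
    rw [hq] at h
    refine (Nat.cast_le (α := ℝ).2 h).trans ?_
    push_cast
    refine mul_le_mul_of_nonneg_right ?_ (Nat.cast_nonneg _)
    linarith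

end River

/-- Following the letter `4` for `L` steps leads to distance at least `L` from the river. -/
lemma le_cayleyDist_of_isRiverWord {Γ : Type*} [Group Γ] {S : Finset Γ} {ψ : List (Fin 5) → Γ}
    (hsep : ∀ w u v, u.head? ≠ v.head? → u.length ≤ v.length →
      v.length ≤ cayleyDist S (ψ (w ++ u)) (ψ (w ++ v)))
    {x : List (Fin 5)} (hx : IsRiverWord x) (w : List (Fin 5)) (L : ℕ) :
    L ≤ cayleyDist S (ψ x.reverse) (ψ (w ++ List.replicate L 4)) := by
  obtain ⟨z, u, v, hu, hv, huv⟩ := exists_common_prefix x.reverse (w ++ List.replicate L 4)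
  have h := (length_le_cayleyDist hsep (w := z) huv).2
  rw [← hu, ← hv] at h
  refine le_trans ?_ h
  have hz : z.count 4 = 0 := List.count_eq_zero.2 fun hmem =>
    hx.1 (List.mem_reverse.1 (hu ▸ List.mem_append_left u hmem))
  have hc := congrArg (List.count 4) hv
  rw [List.count_append, List.count_append, List.count_replicate_self, hz] at hc
  have := v.count_le_length (a := 4)
  omega

/-- The distance to the image of the subtree of river words, shifted by one, is a landscape. -/
lemma isLandscape_of_separated_tree {Γ : Type*} [Group Γ] {S : Finset Γ} {k : ℕ}
    (hgen : Subgroup.closure (S : Set Γ) = ⊤) {ψ : List (Fin 5) → Γ}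
    (hstep : ∀ w i, cayleyDist S (ψ w) (ψ (w ++ [i])) ≤ k)
    (hsep : ∀ w u v, u.head? ≠ v.head? → u.length ≤ v.length →
      v.length ≤ cayleyDist S (ψ (w ++ u)) (ψ (w ++ v))) :
    IsLandscape S (fun γ => (fun _ => false,
      (((⨅ x : {l // IsRiverWord l}, cayleyDist S (ψ x.1.reverse) γ) + 1 : ℕ) : ℕ∞))) := by
  have hconn := cayley_connected hgen
  have : Nonempty {l // IsRiverWord l} := ⟨⟨[], isRiverWord_nil⟩⟩
  set D : Γ → ℕ := fun γ => ⨅ x : {l // IsRiverWord l}, cayleyDist S (ψ x.1.reverse) γ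
  set y : Γ → LandscapeAlphabet := fun γ => (fun _ => false, ((D γ + 1 : ℕ) : ℕ∞))
  have hheight : ∀ γ, height y γ = D γ + 1 := fun γ => rfl
  have hle : ∀ γ (x : {l // IsRiverWord l}), D γ ≤ cayleyDist S (ψ x.1.reverse) γ :=
    fun γ x => ciInf_le' _ x
  have hex : ∀ γ, ∃ x : {l // IsRiverWord l}, cayleyDist S (ψ x.1.reverse) γ = D γ :=
    fun γ => ciInf_mem _
  have hriver : ∀ x, IsRiverWord x → height y (ψ x.reverse) = 1 := by
    intro x hx
    have := hle (ψ x.reverse) ⟨x, hx⟩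
    rw [hheight]
    simpa [cayleyDist] using this
  have hlip : ∀ γ δ, D γ ≤ D δ + cayleyDist S δ γ := by
    intro γ δ
    obtain ⟨x, hx⟩ := hex δ
    rw [← hx]
    exact (hle γ x).trans (cayleyDist_triangle hgen _ _ _)
  refine ⟨fun γ => ENat.natCast_ne_top _, ?_, ?_, ?_, ?_⟩
  · intro γ δ h
    have h1 := hlip γ δ
    have h2 := hlip δ γ
    rw [cayleyDist_comm, h] at h1
    rw [h] at h2
    rw [hheight, hheight, abs_le]
    push_cast
    omega
  · intro n hn
    refine ⟨n + 1, by omega, fun γ hγ => ?_⟩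
    obtain ⟨x, hx⟩ := hex γ
    rw [hheight] at hγ
    exact ⟨ψ x.1.reverse, by omega, hriver x.1 x.2⟩
  · intro l _
    refine ⟨k * l + 2, by omega, fun γ hγ => ?_⟩
    obtain ⟨x, hx⟩ := hex γ
    rw [hheight] at hγ
    obtain rfl : ψ x.1.reverse = γ := hconn.dist_eq_zero_iff.1 (hx.trans (by omega))
    -- the points of the river along the letter `0` below the given one
    have hinj : Function.Injective fun i : ℕ => ψ (x.1.reverse ++ List.replicate i 0) := by
      intro i j hij
      simpa using congrArg List.length (injective_of_separated hsep hij)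
    have hcard : (((Finset.range l).map ⟨_, hinj⟩ : Finset Γ) : Set Γ).encard = l := by
      rw [Set.encard_coe_eq_coe_finsetCard, Finset.card_map, Finset.card_range]
    rw [← hcard]
    refine Set.encard_le_encard ?_
    intro δ hδ
    obtain ⟨i, hi, rfl⟩ := Finset.mem_map.1 (Finset.mem_coe.1 hδ)
    refine ⟨?_, ?_⟩
    · refine (cayleyDist_append_le hgen hstep _ _).trans ?_
      rw [List.length_replicate]
      exact (Nat.mul_le_mul_left k (Finset.mem_range.1 hi).le).trans (Nat.le_add_right _ _)
    · have := hriver _ (x.2.replicate_append i)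
      rwa [List.reverse_append, List.reverse_replicate] at this
  · intro m _
    refine ⟨m + k * m + 2, by omega, fun δ => ?_⟩
    obtain ⟨x, hx⟩ := hex δ
    by_cases hδ : m ≤ D δ
    · exact ⟨δ, by simp [cayleyDist], by rw [hheight]; omega⟩
    · -- leave the river through the letter `4` at a point of the river nearest to `δ`
      refine ⟨ψ (x.1.reverse ++ List.replicate m 4), ?_, ?_⟩
      · have h1 := cayleyDist_append_le hgen hstep x.1.reverse (List.replicate m 4)
        rw [List.length_replicate] at h1
        have h2 := cayleyDist_triangle hgen δ (ψ x.1.reverse)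
          (ψ (x.1.reverse ++ List.replicate m 4))
        rw [cayleyDist_comm δ (ψ x.1.reverse), hx] at h2
        omega
      · obtain ⟨z, hz⟩ := hex (ψ (x.1.reverse ++ List.replicate m 4))
        have := le_cayleyDist_of_isRiverWord hsep z.2 x.1.reverse m
        rw [hheight]
        omega

end Landscape

theorem proposition5p1 {Γ : Type*} [Group Γ] (S : Finset Γ)
    (hsymm : ∀ s ∈ S, s⁻¹ ∈ S) (hgen : Subgroup.closure (S : Set Γ) = ⊤)
    (hΓ : ¬ IsAmenableGroup Γ) :
    ∃ y : Γ → LandscapeAlphabet, Landscape.IsLandscapeWithRiver S y := by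
  obtain ⟨k, ψ, hroot, hstep, hsep⟩ := Landscape.exists_separated_tree hsymm hgen hΓ 5
  exact ⟨_, Landscape.isLandscape_of_separated_tree hgen hstep hsep, _,
    Landscape.wordTree Landscape.IsRiverWord, fun x => ψ x.1.reverse,
    Landscape.isFourTree_wordTree_isRiverWord,
    Landscape.isBilipschitzEmbedding_wordTree hgen Landscape.isRiverWord_nil
      (fun _ _ h => h.of_cons) hstep hsep,
    ⟨⟨[], Landscape.isRiverWord_nil⟩, hroot⟩, fun _ => rfl⟩
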